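/- Let $d>1$ and $r\ge 1$ be integers and let $\mathcal H_1,\dots,\mathcal H_d$ be separable Hilbert spaces with Hilbert space tensor product $\mathcal H=\bigotimes_{j=1}^d\mathcal H_j$. For $1\le j\le d$ and $1\le k\le r$ let $\{f_{j,k,n}\}_{n>0}$ be a sequence in $\mathcal H_j$, such that for each $j$ the $r$ sequences $\{f_{j,1,n}\}_{n>0},\dots,\{f_{j,r,n}\}_{n>0}$ are linearly independent (as elements of the vector space of all sequences in $\mathcal H_j$). Let $\mathcal F=\{f_{n_1,\dots,n_d}\}_{n_1,\dots,n_d>0}$ be the multi-indexed sequence in $\mathcal H$ given by $$f_{n_1,\dots,n_d}=\sum_{k=1}^r\ \bigotimes_{j=1}^d f_{j,k,n_j}.$$ A countable family $\{g_n\}$ in a Hilbert space $\mathcal K$ is a Bessel sequence if there is $B>0$ with $\sum_n|\langle g,g_n\rangle|^2\le B\|g\|^2$ for all $g\in\mathcal K$, and a frame if there are $A,B>0$ with $A\|g\|^2\le\sum_n|\langle g,g_n\rangle|^2\le B\|g\|^2$ for all $g\in\mathcal K$. (i) $\mathcal F$ is a Bessel sequence in $\mathcal H$ if and only if $\{f_{j,k,n}\}_{n>0}$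 is a Bessel sequence in $\mathcal H_j$ for each $(j,k)\in\{1,\dots,d\}\times\{1,\dots,r\}$. (ii) If $\mathcal F$ is a frame in $\mathcal H$, then for each $j=1,\dots,d$ the concatenated sequence $\{f_{j,k,n}\}_{1\le k\le r,\ n>0}$ is a frame in $\mathcal H_j$. -/

import Mathlib

open scoped TensorProduct ComplexConjugate

section HilbertTensorProduct

variable {ι : Type*} [Fintype ι] {𝕜 : Type*} [RCLike 𝕜]
  {H : ι → Type*} [∀ j, NormedAddCommGroup (H j)] [∀ j, InnerProductSpace 𝕜 (H j)]

/-- The linear functional on the algebraic tensor product determined by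
`⨂ⱼ wⱼ ↦ ∏ⱼ ⟪vⱼ, wⱼ⟫`. -/
noncomputable def tensorFunctional (v : ∀ j, H j) : (⨂[𝕜] j, H j) →ₗ[𝕜] 𝕜 :=
  PiTensorProduct.lift
    ((MultilinearMap.mkPiAlgebra 𝕜 ι 𝕜).compLinearMap fun j => innerₛₗ 𝕜 (v j))

theorem tensorFunctional_tprod (v w : ∀ j, H j) :
    tensorFunctional v (PiTensorProduct.tprod 𝕜 w) = ∏ j, inner 𝕜 (v j) (w j) := by
  simp [tensorFunctional]

theorem tensorFunctional_update_add [DecidableEq ι] (v : ∀ j, H j) (i : ι) (a b : H i)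
    (y : ⨂[𝕜] j, H j) :
    tensorFunctional (Function.update v i (a + b)) y =
      tensorFunctional (Function.update v i a) y + tensorFunctional (Function.update v i b) y := by
  induction y using PiTensorProduct.induction_on with
  | smul_tprod r w =>
    simp only [map_smul, tensorFunctional_tprod, smul_eq_mul, ← mul_add]
    congr 1
    rw [← Finset.mul_prod_erase _ _ (Finset.mem_univ i),
      ← Finset.mul_prod_erase _ _ (Finset.mem_univ i),
      ← Finset.mul_prod_erase _ _ (Finset.mem_univ i)]
    simp only [Function.update_self, inner_add_left, add_mul]
    congr 2 <;> refine Finset.prod_congr rfl fun j hj => ?_ <;>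
      simp [Function.update_of_ne (Finset.ne_of_mem_erase hj)]
  | add x y hx hy => simp only [map_add, hx, hy]; ring

theorem tensorFunctional_update_smul [DecidableEq ι] (v : ∀ j, H j) (i : ι) (c : 𝕜) (a : H i)
    (y : ⨂[𝕜] j, H j) :
    tensorFunctional (Function.update v i (c • a)) y =
      conj c * tensorFunctional (Function.update v i a) y := by
  induction y using PiTensorProduct.induction_on with
  | smul_tprod r w =>
    simp only [map_smul, tensorFunctional_tprod, smul_eq_mul]
    rw [mul_left_comm]
    congr 1
    rw [← Finset.mul_prod_erase _ _ (Finset.mem_univ i),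
      ← Finset.mul_prod_erase _ _ (Finset.mem_univ i)]
    simp only [Function.update_self, inner_smul_left, mul_assoc]
    congr 2; refine Finset.prod_congr rfl fun j hj => ?_
    simp [Function.update_of_ne (Finset.ne_of_mem_erase hj)]
  | add x y hx hy => simp only [map_add, hx, hy]; ring

/-- The multilinear map `v ↦ conj (φᵥ y)`, where `φᵥ` is `tensorFunctional v`. -/
noncomputable def conjTensorFunctional (y : ⨂[𝕜] j, H j) : MultilinearMap 𝕜 H 𝕜 where
  toFun v := conj (tensorFunctional v y)
  map_update_add' v i a b := by rw [tensorFunctional_update_add, map_add]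
  map_update_smul' v i c a := by
    rw [tensorFunctional_update_smul, map_mul, RCLike.conj_conj, smul_eq_mul]

/-- The sesquilinear form (conjugate linear in the first variable) on the algebraic tensor product
with `⟪⨂ⱼ vⱼ, ⨂ⱼ wⱼ⟫ = ∏ⱼ ⟪vⱼ, wⱼ⟫`. -/
noncomputable def tensorInner (x y : ⨂[𝕜] j, H j) : 𝕜 :=
  conj (PiTensorProduct.lift (conjTensorFunctional y) x)

theorem tensorInner_tprod_left (v : ∀ j, H j) (y : ⨂[𝕜] j, H j) :
    tensorInner (PiTensorProduct.tprod 𝕜 v) y = tensorFunctional v y := by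
  simp [tensorInner, conjTensorFunctional]

theorem tensorInner_tprod (v w : ∀ j, H j) :
    tensorInner (PiTensorProduct.tprod 𝕜 v) (PiTensorProduct.tprod 𝕜 w) =
      ∏ j, inner 𝕜 (v j) (w j) := by
  rw [tensorInner_tprod_left, tensorFunctional_tprod]

theorem tensorInner_add_left (x y z : ⨂[𝕜] j, H j) :
    tensorInner (x + y) z = tensorInner x z + tensorInner y z := by
  simp [tensorInner]

theorem tensorInner_smul_left (c : 𝕜) (x y : ⨂[𝕜] j, H j) :
    tensorInner (c • x) y = conj c * tensorInner x y := by
  simp [tensorInner]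

theorem tensorInner_conj_symm (x y : ⨂[𝕜] j, H j) :
    conj (tensorInner y x) = tensorInner x y := by
  induction x using PiTensorProduct.induction_on with
  | smul_tprod r v =>
    induction y using PiTensorProduct.induction_on with
    | smul_tprod s w =>
      rw [tensorInner_smul_left, tensorInner_smul_left, tensorInner_tprod_left,
        tensorInner_tprod_left, map_smul, map_smul, tensorFunctional_tprod, tensorFunctional_tprod]
      simp only [map_mul, smul_eq_mul, map_prod, RCLike.conj_conj, inner_conj_symm]
      ring
    | add y z hy hz =>
      rw [tensorInner_add_left, map_add, hy, hz, tensorInner_smul_left, tensorInner_smul_left,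
        tensorInner_smul_left, tensorInner_tprod_left, tensorInner_tprod_left,
        tensorInner_tprod_left, map_add, mul_add]
  | add x z hx hz =>
    rw [tensorInner_add_left, ← hx, ← hz, ← map_add]
    congr 1
    clear hx hz
    induction y using PiTensorProduct.induction_on with
    | smul_tprod s w =>
      simp only [tensorInner_smul_left, tensorInner_tprod_left, map_add, mul_add]
    | add y y' hy hy' => simp only [tensorInner_add_left, hy, hy']; ring

theorem tensorInner_add_right (x y z : ⨂[𝕜] j, H j) :
    tensorInner x (y + z) = tensorInner x y + tensorInner x z := by
  rw [← tensorInner_conj_symm, tensorInner_add_left, map_add, tensorInner_conj_symm,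
    tensorInner_conj_symm]

theorem tensorInner_smul_right (c : 𝕜) (x y : ⨂[𝕜] j, H j) :
    tensorInner x (c • y) = c * tensorInner x y := by
  rw [← tensorInner_conj_symm, tensorInner_smul_left, map_mul, RCLike.conj_conj,
    tensorInner_conj_symm]

theorem tensorInner_sum_left {α : Type*} (s : Finset α) (g : α → ⨂[𝕜] j, H j)
    (y : ⨂[𝕜] j, H j) : tensorInner (∑ a ∈ s, g a) y = ∑ a ∈ s, tensorInner (g a) y := by
  simp [tensorInner]

theorem tensorInner_sum_right {α : Type*} (s : Finset α) (g : α → ⨂[𝕜] j, H j)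
    (x : ⨂[𝕜] j, H j) : tensorInner x (∑ a ∈ s, g a) = ∑ a ∈ s, tensorInner x (g a) := by
  rw [← tensorInner_conj_symm, tensorInner_sum_left, map_sum]
  simp only [tensorInner_conj_symm]

theorem tensorInner_mapIncl (p : ∀ j, Submodule 𝕜 (H j)) (x y : ⨂[𝕜] j, p j) :
    tensorInner (PiTensorProduct.mapIncl p x) (PiTensorProduct.mapIncl p y) = tensorInner x y := by
  induction x using PiTensorProduct.induction_on with
  | smul_tprod r v =>
    induction y using PiTensorProduct.induction_on with
    | smul_tprod s w =>
      simp [PiTensorProduct.mapIncl, tensorInner_smul_left, tensorInner_smul_right,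
        tensorInner_tprod]
    | add y z hy hz => rw [map_add, tensorInner_add_right, tensorInner_add_right, hy, hz]
  | add x z hx hz => rw [map_add, tensorInner_add_left, tensorInner_add_left, hx, hz]

theorem exists_finiteDimensional_mapIncl {ι 𝕜 : Type*} [RCLike 𝕜] {H : ι → Type*}
    [∀ j, NormedAddCommGroup (H j)] [∀ j, InnerProductSpace 𝕜 (H j)] (x : ⨂[𝕜] j, H j) :
    ∃ p : ∀ j, Submodule 𝕜 (H j), (∀ j, FiniteDimensional 𝕜 (p j)) ∧
      ∃ z : ⨂[𝕜] j, p j, PiTensorProduct.mapIncl p z = x := by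
  induction x using PiTensorProduct.induction_on with
  | smul_tprod r v =>
    refine ⟨fun j => Submodule.span 𝕜 {v j}, fun j => inferInstance,
      r • PiTensorProduct.tprod 𝕜 fun j => ⟨v j, Submodule.mem_span_singleton_self _⟩, ?_⟩
    simp [PiTensorProduct.mapIncl]
  | add x y hx hy =>
    obtain ⟨p, hp, z, rfl⟩ := hx
    obtain ⟨q, hq, w, rfl⟩ := hy
    refine ⟨fun j => p j ⊔ q j, fun j => inferInstance,
      PiTensorProduct.map (fun j => Submodule.inclusion le_sup_left) z +
        PiTensorProduct.map (fun j => Submodule.inclusion le_sup_right) w, ?_⟩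
    rw [map_add]
    simp only [PiTensorProduct.mapIncl, ← LinearMap.comp_apply, ← PiTensorProduct.map_comp]
    rfl

theorem tensorInner_self (x : ⨂[𝕜] j, H j) :
    0 ≤ RCLike.re (tensorInner x x) ∧ (tensorInner x x = 0 → x = 0) := by
  classical
  obtain ⟨p, hp, z, rfl⟩ := exists_finiteDimensional_mapIncl x
  rw [tensorInner_mapIncl]
  let e := fun j => stdOrthonormalBasis 𝕜 (p j)
  let b := Basis.piTensorProduct fun j => (e j).toBasis
  have horth : ∀ I J, tensorInner (b I) (b J) = if I = J then (1 : 𝕜) else 0 := by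
    intro I J
    simp only [b, Basis.piTensorProduct_apply, tensorInner_tprod, OrthonormalBasis.coe_toBasis,
      orthonormal_iff_ite.mp (e _).orthonormal]
    rw [Fintype.prod_ite_zero]
    simp [funext_iff]
  have key : tensorInner z z = ((∑ I, ‖b.repr z I‖ ^ 2 : ℝ) : 𝕜) := by
    conv_lhs => rw [← b.sum_repr z]
    simp only [tensorInner_sum_left, tensorInner_sum_right, tensorInner_smul_left,
      tensorInner_smul_right, horth]
    simp [mul_comm _ ((starRingEnd 𝕜) _), RCLike.conj_mul]
  rw [key]
  refine ⟨by rw [RCLike.ofReal_re]; positivity, fun h => ?_⟩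
  have h0 : ∑ I, ‖b.repr z I‖ ^ 2 = 0 := by exact_mod_cast h
  rw [Finset.sum_eq_zero_iff_of_nonneg fun _ _ => by positivity] at h0
  have hz : z = 0 := by
    rw [← b.sum_repr z]
    refine Finset.sum_eq_zero fun I hI => ?_
    rw [norm_eq_zero.mp (pow_eq_zero_iff two_ne_zero |>.mp (h0 I hI)), zero_smul]
  rw [hz, map_zero]

variable (𝕜 H) in
/-- The algebraic tensor product `⨂ⱼ Hⱼ` of a finite family of inner product spaces, as an inner
product space with `⟪⨂ⱼ vⱼ, ⨂ⱼ wⱼ⟫ = ∏ⱼ ⟪vⱼ, wⱼ⟫`. It is a type synonym because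
`PiTensorProduct` carries the projective norm in Mathlib. -/
def AlgTensor : Type _ := ⨂[𝕜] j, H j

noncomputable instance : AddCommGroup (AlgTensor 𝕜 H) :=
  inferInstanceAs (AddCommGroup (⨂[𝕜] j, H j))

noncomputable instance : Module 𝕜 (AlgTensor 𝕜 H) :=
  inferInstanceAs (Module 𝕜 (⨂[𝕜] j, H j))

variable (𝕜 H) in
/-- The inner product on the algebraic tensor product is an inner product. -/
@[reducible]
noncomputable def AlgTensor.core : InnerProductSpace.Core 𝕜 (AlgTensor 𝕜 H) where
  inner x y := tensorInner (H := H) x y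
  conj_inner_symm x y := tensorInner_conj_symm (H := H) x y
  re_inner_nonneg x := (tensorInner_self (H := H) x).1
  add_left x y z := tensorInner_add_left (H := H) x y z
  smul_left x y c := tensorInner_smul_left (H := H) c x y
  definite x hx := (tensorInner_self (H := H) x).2 hx

noncomputable instance : NormedAddCommGroup (AlgTensor 𝕜 H) :=
  (AlgTensor.core 𝕜 H).toNormedAddCommGroup

noncomputable instance : InnerProductSpace 𝕜 (AlgTensor 𝕜 H) :=
  InnerProductSpace.ofCore (AlgTensor.core 𝕜 H).toCore

variable (𝕜 H) in
/-- The Hilbert space tensor product `⨂ⱼ Hⱼ` of a finite family of Hilbert spaces: the completion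
of the algebraic tensor product for the inner product `⟪⨂ⱼ vⱼ, ⨂ⱼ wⱼ⟫ = ∏ⱼ ⟪vⱼ, wⱼ⟫`. -/
abbrev HilbertTensor : Type _ := UniformSpace.Completion (AlgTensor 𝕜 H)

variable (𝕜) in
/-- The elementary tensor `⨂ⱼ vⱼ` in the algebraic tensor product. -/
noncomputable def AlgTensor.pure (v : ∀ j, H j) : AlgTensor 𝕜 H := PiTensorProduct.tprod 𝕜 v

variable (𝕜) in
/-- The elementary tensor `⨂ⱼ vⱼ` in the Hilbert space tensor product. -/
noncomputable def HilbertTensor.pure (v : ∀ j, H j) : HilbertTensor 𝕜 H :=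
  ((AlgTensor.pure 𝕜 v : AlgTensor 𝕜 H) : UniformSpace.Completion (AlgTensor 𝕜 H))

theorem HilbertTensor.inner_pure (v w : ∀ j, H j) :
    inner 𝕜 (HilbertTensor.pure 𝕜 v) (HilbertTensor.pure 𝕜 w) = ∏ j, inner 𝕜 (v j) (w j) := by
  rw [HilbertTensor.pure, HilbertTensor.pure, UniformSpace.Completion.inner_coe]
  exact tensorInner_tprod v w

end HilbertTensorProduct

section Frames

variable (𝕜 : Type*) [RCLike 𝕜] {ι E : Type*} [NormedAddCommGroup E] [InnerProductSpace 𝕜 E]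

/-- The family `f` is a Bessel sequence: for some `B > 0` and all `x`,
`∑ₙ |⟪x, fₙ⟫|² ≤ B ‖x‖²` (in particular the series converges). -/
def IsBesselSeq (f : ι → E) : Prop :=
  ∃ B : ℝ, 0 < B ∧ ∀ x : E, Summable (fun n => ‖inner 𝕜 x (f n)‖ ^ 2) ∧
    ∑' n, ‖inner 𝕜 x (f n)‖ ^ 2 ≤ B * ‖x‖ ^ 2

/-- The family `f` is a frame: for some `A, B > 0` and all `x`,
`A ‖x‖² ≤ ∑ₙ |⟪x, fₙ⟫|² ≤ B ‖x‖²` (in particular the series converges). -/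
def IsFrameSeq (f : ι → E) : Prop :=
  ∃ A B : ℝ, 0 < A ∧ 0 < B ∧ ∀ x : E, Summable (fun n => ‖inner 𝕜 x (f n)‖ ^ 2) ∧
    A * ‖x‖ ^ 2 ≤ ∑' n, ‖inner 𝕜 x (f n)‖ ^ 2 ∧ ∑' n, ‖inner 𝕜 x (f n)‖ ^ 2 ≤ B * ‖x‖ ^ 2

end Frames

section TensorSums

variable (𝕜 : Type*) [RCLike 𝕜] {ι κ N : Type*} [Fintype ι] [Fintype κ]
  {H : ι → Type*} [∀ j, NormedAddCommGroup (H j)] [∀ j, InnerProductSpace 𝕜 (H j)]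

/-- The multi-indexed sequence `(nⱼ)ⱼ ↦ ∑ₖ ⨂ⱼ f_{j,k,nⱼ}` in the Hilbert space tensor product. -/
noncomputable def tensorSumSeq (f : ∀ j, κ → N → H j) (n : ι → N) : HilbertTensor 𝕜 H :=
  ∑ k, HilbertTensor.pure 𝕜 fun j => f j k (n j)

end TensorSums

/-! Working with sums in `ℝ≥0∞` lets them be split, reordered and compared freely. If all `f j k`
are Bessel, each tensor family `⨂ⱼ f j k` is Bessel with the product of the bounds
(`besselSum_pure_le`): start from tensors of orthonormal bases and exchange one factor at a time,
Riesz representation reducing each exchange to the Bessel bound in one space. A finite sum of Bessel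
families is Bessel. Conversely, linear independence supplies finite combinations of functionals `⟪v,
· n⟫` that give 1 on `f j k₀` and 0 on the other `f j k`. Applied in all slots but `i`, they write
`⟪x, f i k₀ n⟫` as a finite combination of inner products of elementary tensors containing `x` with
members of the tensor family, whose bound then passes to `f i k₀`. For frames, the lower bound is
tested on `x` tensored with fixed nonzero vectors. Each summand factors as the Bessel sum of `f i k`
at `x` times a constant, finite by the Bessel part. -/

open scoped ENNReal NNReal

/-! ### Bessel sums with values in `ℝ≥0∞` -/

section BesselSum

variable (𝕜 : Type*) [RCLike 𝕜] {ι E : Type*} [NormedAddCommGroup E] [InnerProductSpace 𝕜 E]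

/-- The extended real number `∑ₙ |⟪x, fₙ⟫|²`. -/
noncomputable def besselSum (f : ι → E) (x : E) : ℝ≥0∞ := ∑' n, ‖inner 𝕜 x (f n)‖ₑ ^ 2

theorem enorm_sq_eq_ofReal {F : Type*} [NormedAddCommGroup F] (a : F) :
    ‖a‖ₑ ^ 2 = ENNReal.ofReal (‖a‖ ^ 2) := by
  rw [ENNReal.ofReal_pow (norm_nonneg a), ofReal_norm]

theorem besselSum_eq_ofReal {f : ι → E} {x : E}
    (h : Summable fun n => ‖inner 𝕜 x (f n)‖ ^ 2) :
    besselSum 𝕜 f x = ENNReal.ofReal (∑' n, ‖inner 𝕜 x (f n)‖ ^ 2) := by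
  rw [ENNReal.ofReal_tsum_of_nonneg (fun _ => by positivity) h]
  simp only [besselSum, enorm_sq_eq_ofReal]

theorem summable_of_besselSum_ne_top {f : ι → E} {x : E} (h : besselSum 𝕜 f x ≠ ∞) :
    Summable fun n => ‖inner 𝕜 x (f n)‖ ^ 2 := by
  have := ENNReal.summable_toReal h
  simpa using this

theorem isBesselSeq_iff {f : ι → E} :
    IsBesselSeq 𝕜 f ↔ ∃ C : ℝ≥0, ∀ x, besselSum 𝕜 f x ≤ C * ‖x‖ₑ ^ 2 := by
  constructor
  · rintro ⟨B, hB, h⟩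
    refine ⟨B.toNNReal, fun x => ?_⟩
    rw [besselSum_eq_ofReal 𝕜 (h x).1, enorm_sq_eq_ofReal, ← ENNReal.ofReal,
      ← ENNReal.ofReal_mul hB.le]
    exact ENNReal.ofReal_le_ofReal (h x).2
  · rintro ⟨C, h⟩
    -- `C` may be zero, whereas a Bessel bound must be positive.
    refine ⟨C + 1, by positivity, fun x => ?_⟩
    have hs := summable_of_besselSum_ne_top 𝕜 (f := f) (x := x)
      (ne_top_of_le_ne_top (by finiteness) (h x))
    refine ⟨hs, ?_⟩
    have h1 := h x
    rw [besselSum_eq_ofReal 𝕜 hs, enorm_sq_eq_ofReal, ← ENNReal.ofReal_coe_nnreal,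
      ← ENNReal.ofReal_mul C.coe_nonneg, ENNReal.ofReal_le_ofReal_iff (by positivity)] at h1
    nlinarith [sq_nonneg ‖x‖]

/-- Triangle inequality, then Cauchy–Schwarz against the constant 1. -/
theorem enorm_sum_sq_le {α F : Type*} [NormedAddCommGroup F] (s : Finset α) (a : α → F) :
    ‖∑ i ∈ s, a i‖ₑ ^ 2 ≤ s.card * ∑ i ∈ s, ‖a i‖ₑ ^ 2 := by
  simp only [enorm_eq_nnnorm]
  norm_cast
  exact (pow_le_pow_left' (nnnorm_sum_le s a) 2).trans sq_sum_le_card_mul_sum_sq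

theorem besselSum_sum_le {κ : Type*} [Fintype κ] (f : κ → ι → E) (x : E) :
    besselSum 𝕜 (fun n => ∑ k, f k n) x ≤ Fintype.card κ * ∑ k, besselSum 𝕜 (f k) x := by
  simp only [besselSum]
  rw [← Summable.tsum_finsetSum fun _ _ => ENNReal.summable, ← ENNReal.tsum_mul_left]
  refine ENNReal.tsum_le_tsum fun n => ?_
  rw [inner_sum]
  exact enorm_sum_sq_le _ _

theorem Orthonormal.besselSum_le {f : ι → E} (hf : Orthonormal 𝕜 f) (x : E) :
    besselSum 𝕜 f x ≤ ‖x‖ₑ ^ 2 := by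
  have hc : ∀ n, ‖inner 𝕜 x (f n)‖ = ‖inner 𝕜 (f n) x‖ := fun n => norm_inner_symm _ _
  have hs : Summable fun n => ‖inner 𝕜 x (f n)‖ ^ 2 := by
    simpa only [hc] using hf.inner_products_summable (x := x)
  rw [besselSum_eq_ofReal 𝕜 hs, enorm_sq_eq_ofReal]
  simp only [hc]
  exact ENNReal.ofReal_le_ofReal (hf.tsum_inner_products_le (x := x))

/-- Parseval: it turns a bound by `‖x‖²` into domination of one family by another, the form needed
for exchanging tensor factors. -/
theorem HilbertBasis.besselSum_eq [CompleteSpace E] (b : HilbertBasis ι 𝕜 E) (x : E) :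
    besselSum 𝕜 b x = ‖x‖ₑ ^ 2 := by
  have h := (b.hasSum_inner_mul_inner x x).mapL RCLike.reCLM
  have h2 : HasSum (fun n => ‖inner 𝕜 x (b n)‖ ^ 2) (‖x‖ ^ 2) := by
    convert! h using 1
    · ext n
      rw [← inner_conj_symm (b n) x, RCLike.mul_conj, ← RCLike.ofReal_pow]
      simp only [RCLike.reCLM_apply, RCLike.ofReal_re]
    · simp
  rw [besselSum_eq_ofReal 𝕜 h2.summable, h2.tsum_eq, enorm_sq_eq_ofReal]

end BesselSum

/-! ### Tensor products of Bessel families, one factor at a time -/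

section Slots

variable {ι : Type*} [Fintype ι] {𝕜 : Type*} [RCLike 𝕜]
  {H : ι → Type*} [∀ j, NormedAddCommGroup (H j)] [∀ j, InnerProductSpace 𝕜 (H j)]

theorem HilbertTensor.enorm_pure (v : ∀ j, H j) :
    ‖(HilbertTensor.pure 𝕜 v : HilbertTensor 𝕜 H)‖ₑ = ∏ j, ‖v j‖ₑ := by
  have h : ‖(HilbertTensor.pure 𝕜 v : HilbertTensor 𝕜 H)‖ = ∏ j, ‖v j‖ := by
    have h2 := congrArg RCLike.re (HilbertTensor.inner_pure (𝕜 := 𝕜) v v)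
    rw [inner_self_eq_norm_sq] at h2
    simp only [inner_self_eq_norm_sq_to_K] at h2
    rw [← Finset.prod_congr rfl (fun j _ => RCLike.ofReal_pow (K := 𝕜) ‖v j‖ 2),
      ← RCLike.ofReal_prod, RCLike.ofReal_re, Finset.prod_pow] at h2
    exact (pow_left_inj₀ (norm_nonneg _) (by positivity) two_ne_zero).mp h2
  rw [← ofReal_norm, h, ENNReal.ofReal_prod_of_nonneg fun _ _ => norm_nonneg _]
  simp only [ofReal_norm]

theorem HilbertTensor.norm_pure (v : ∀ j, H j) :
    ‖(HilbertTensor.pure 𝕜 v : HilbertTensor 𝕜 H)‖ = ∏ j, ‖v j‖ := by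
  rw [← toReal_enorm, HilbertTensor.enorm_pure, ENNReal.toReal_prod]
  simp

variable [DecidableEq ι]

variable (𝕜) in
/-- The elementary tensor as a linear map in its `i`-th factor. -/
noncomputable def HilbertTensor.pureSlot (v : ∀ j, H j) (i : ι) : H i →ₗ[𝕜] HilbertTensor 𝕜 H :=
  (UniformSpace.Completion.toComplₗᵢ (𝕜 := 𝕜) (E := AlgTensor 𝕜 H)).toLinearMap ∘ₗ
    (show H i →ₗ[𝕜] AlgTensor 𝕜 H from (PiTensorProduct.tprod 𝕜 (s := H)).toLinearMap v i)

theorem HilbertTensor.pureSlot_apply (v : ∀ j, H j) (i : ι) (h : H i) :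
    HilbertTensor.pureSlot 𝕜 v i h = HilbertTensor.pure 𝕜 (Function.update v i h) := rfl

/-- The partial inner product of `x` against an elementary tensor with one free factor. -/
theorem HilbertTensor.exists_partialInner (x : HilbertTensor 𝕜 H) (v : ∀ j, H j) (i : ι)
    [CompleteSpace (H i)] :
    ∃ y : H i, ∀ h, inner 𝕜 y h = inner 𝕜 x (HilbertTensor.pure 𝕜 (Function.update v i h)) := by
  let T : H i →L[𝕜] HilbertTensor 𝕜 H :=
    (HilbertTensor.pureSlot 𝕜 v i).mkContinuous (∏ j ∈ Finset.univ.erase i, ‖v j‖) fun h => by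
      rw [HilbertTensor.pureSlot_apply, HilbertTensor.norm_pure,
        ← Finset.mul_prod_erase _ _ (Finset.mem_univ i), Function.update_self, mul_comm]
      refine le_of_eq (congrArg (· * _) (Finset.prod_congr rfl fun j hj => ?_))
      rw [Function.update_of_ne (Finset.ne_of_mem_erase hj)]
  refine ⟨(InnerProductSpace.toDual 𝕜 (H i)).symm ((innerSL 𝕜 x).comp T), fun h => ?_⟩
  rw [InnerProductSpace.toDual_symm_apply]
  rfl

/-- Replacing one factor of a tensor product of families by a dominated one. -/
theorem besselSum_pure_le_of_slot {L : ι → Type*} {g g' : ∀ j, L j → H j} {i : ι}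
    [CompleteSpace (H i)] {C : ℝ≥0∞} (hg : ∀ j, j ≠ i → g' j = g j)
    (hC : ∀ y, besselSum 𝕜 (g' i) y ≤ C * besselSum 𝕜 (g i) y) (x : HilbertTensor 𝕜 H) :
    besselSum 𝕜 (fun n : ∀ j, L j => HilbertTensor.pure 𝕜 fun j => g' j (n j)) x ≤
      C * besselSum 𝕜 (fun n : ∀ j, L j => HilbertTensor.pure 𝕜 fun j => g j (n j)) x := by
  -- The sum over the index of slot `i` goes innermost, with the other indices frozen in `m`.
  have split : ∀ F : (∀ j, L j) → ℝ≥0∞, ∑' n, F n =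
      ∑' (m : ∀ j : { j // j ≠ i }, L j) (a : L i), F ((Equiv.piSplitAt i L).symm (a, m)) :=
    fun F => by rw [← (Equiv.piSplitAt i L).symm.tsum_eq, ENNReal.tsum_prod', ENNReal.tsum_comm]
  simp only [besselSum]
  rw [split, split, ← ENNReal.tsum_mul_left]
  refine ENNReal.tsum_le_tsum fun m => ?_
  obtain ⟨y, hy⟩ := HilbertTensor.exists_partialInner x
    (fun j => if h : j = i then 0 else g j (m ⟨j, h⟩)) i
  have key : ∀ u : ∀ j, L j → H j, (∀ j, j ≠ i → u j = g j) → ∀ a : L i,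
      (fun j => u j ((Equiv.piSplitAt i L).symm (a, m) j)) =
        Function.update (fun j => if h : j = i then 0 else g j (m ⟨j, h⟩)) i (u i a) := by
    intro u hu a
    ext j
    by_cases h : j = i
    · subst h; simp [Equiv.piSplitAt]
    · simp [Equiv.piSplitAt, h, hu j h]
  simp only [key g' hg, key g fun _ _ => rfl, ← hy]
  exact hC y

/-- The tensor product of Bessel sequences satisfies the product bound. -/
theorem besselSum_pure_le [∀ j, CompleteSpace (H j)] {N : Type*} {g : ∀ j, N → H j}
    {C : ι → ℝ≥0∞} (hC : ∀ j y, besselSum 𝕜 (g j) y ≤ C j * ‖y‖ₑ ^ 2) (x : HilbertTensor 𝕜 H) :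
    besselSum 𝕜 (fun n : ι → N => HilbertTensor.pure 𝕜 fun j => g j (n j)) x ≤
      (∏ j, C j) * ‖x‖ₑ ^ 2 := by
  choose W b hb using fun j => exists_hilbertBasis 𝕜 (H j)
  -- Slots in `S` carry `g j`, the others a Hilbert basis. Padding both by zero to `W j ⊕ N` keeps
  -- the index type independent of `S`.
  let u : Finset ι → ∀ j, W j ⊕ N → H j := fun S j =>
    if j ∈ S then Sum.elim 0 (g j) else Sum.elim (b j) 0
  have hzero : ∀ v : ∀ j, H j, (∃ j, v j = 0) →
      (HilbertTensor.pure 𝕜 v : HilbertTensor 𝕜 H) = 0 := by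
    rintro v ⟨j, hj⟩
    rw [← norm_eq_zero, HilbertTensor.norm_pure]
    exact Finset.prod_eq_zero (Finset.mem_univ j) (by simp [hj])
  have hsum : ∀ S : Finset ι,
      besselSum 𝕜 (fun n : ∀ j, W j ⊕ N => HilbertTensor.pure 𝕜 fun j => u S j (n j)) x ≤
        (∏ j ∈ S, C j) * ‖x‖ₑ ^ 2 := by
    intro S
    induction S using Finset.induction_on with
    | empty =>
      have hinj : Function.Injective fun (m : ∀ j, W j) j => (Sum.inl (m j) : W j ⊕ N) :=
        fun m m' h => funext fun j => Sum.inl_injective (congrFun h j)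
      have horth : Orthonormal 𝕜 fun m : ∀ j, W j =>
          (HilbertTensor.pure 𝕜 fun j => b j (m j) : HilbertTensor 𝕜 H) := by
        classical
        rw [orthonormal_iff_ite]
        intro m m'
        simp only [HilbertTensor.inner_pure, orthonormal_iff_ite.mp (b _).orthonormal]
        rw [Fintype.prod_ite_zero]
        simp [funext_iff]
      rw [Finset.prod_empty, one_mul]
      refine le_trans (le_of_eq ?_) (horth.besselSum_le 𝕜 x)
      -- Only tuples of basis indices contribute: any other tuple has a zero factor.
      rw [besselSum, besselSum, ← hinj.tsum_eq]
      · simp [u]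
      · intro n hn
        by_contra hn'
        refine hn ?_
        have : ∃ j, u ∅ j (n j) = 0 := by
          by_contra! h
          have : ∀ j, ∃ a, Sum.inl a = n j := fun j => by
            have := h j
            rcases hnj : n j with a | a
            · exact ⟨a, rfl⟩
            · simp [u, hnj] at this
          choose a ha using this
          exact hn' ⟨a, funext ha⟩
        simp [hzero _ this]
    | insert i S hi ih =>
      rw [Finset.prod_insert hi, mul_assoc]
      refine le_trans (besselSum_pure_le_of_slot (g := u S) (i := i) (C := C i) ?_ ?_ x)
        (by gcongr)
      · intro j hj
        simp [u, hj]
      · intro y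
        have h1 : besselSum 𝕜 (u (insert i S) i) y = besselSum 𝕜 (g i) y := by
          simp only [besselSum, u, Finset.mem_insert_self, if_true]
          rw [Summable.tsum_sum ENNReal.summable ENNReal.summable]
          simp
        have h2 : besselSum 𝕜 (u S i) y = besselSum 𝕜 (b i) y := by
          simp only [besselSum, u, hi, if_false]
          rw [Summable.tsum_sum ENNReal.summable ENNReal.summable]
          simp
        rw [h1, h2, HilbertBasis.besselSum_eq]
        exact hC i y
  refine le_trans ?_ (hsum Finset.univ)
  have hinj : Function.Injective fun (n : ι → N) j => (Sum.inr (n j) : W j ⊕ N) :=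
    fun m m' h => funext fun j => Sum.inr_injective (congrFun h j)
  refine le_trans (le_of_eq ?_) (ENNReal.tsum_comp_le_tsum_of_injective hinj _)
  simp [besselSum, u]

end Slots

/-! ### Frame bounds and finite unions and sums of families -/

section FrameBounds

variable (𝕜 : Type*) [RCLike 𝕜] {ι E : Type*} [NormedAddCommGroup E] [InnerProductSpace 𝕜 E]

theorem isFrameSeq_iff {f : ι → E} :
    IsFrameSeq 𝕜 f ↔
      IsBesselSeq 𝕜 f ∧ ∃ A : ℝ≥0, 0 < A ∧ ∀ x, A * ‖x‖ₑ ^ 2 ≤ besselSum 𝕜 f x := by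
  constructor
  · rintro ⟨A, B, hA, hB, h⟩
    refine ⟨⟨B, hB, fun x => ⟨(h x).1, (h x).2.2⟩⟩, A.toNNReal, by simpa using hA, fun x => ?_⟩
    rw [besselSum_eq_ofReal 𝕜 (h x).1, enorm_sq_eq_ofReal, ← ENNReal.ofReal,
      ← ENNReal.ofReal_mul hA.le]
    exact ENNReal.ofReal_le_ofReal (h x).2.1
  · rintro ⟨⟨B, hB, h⟩, A, hA, hA'⟩
    refine ⟨A, B, by simpa using hA, hB, fun x => ⟨(h x).1, ?_, (h x).2⟩⟩
    have h1 := hA' x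
    rwa [besselSum_eq_ofReal 𝕜 (h x).1, enorm_sq_eq_ofReal, ← ENNReal.ofReal_coe_nnreal,
      ← ENNReal.ofReal_mul A.coe_nonneg, ENNReal.ofReal_le_ofReal_iff
        (tsum_nonneg fun _ => by positivity)] at h1

theorem besselSum_prod {κ : Type*} [Fintype κ] (f : κ → ι → E) (x : E) :
    besselSum 𝕜 (fun p : κ × ι => f p.1 p.2) x = ∑ k, besselSum 𝕜 (f k) x := by
  rw [besselSum, ENNReal.tsum_prod', tsum_fintype]
  rfl

theorem IsBesselSeq.prod {κ : Type*} [Fintype κ] {f : κ → ι → E}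
    (h : ∀ k, IsBesselSeq 𝕜 (f k)) : IsBesselSeq 𝕜 (fun p : κ × ι => f p.1 p.2) := by
  simp only [isBesselSeq_iff] at h ⊢
  choose C hC using h
  refine ⟨∑ k, C k, fun x => ?_⟩
  rw [besselSum_prod, ENNReal.ofNNReal_finsetSum, Finset.sum_mul]
  exact Finset.sum_le_sum fun k _ => hC k x

theorem IsBesselSeq.sum {κ : Type*} [Fintype κ] {f : κ → ι → E}
    (h : ∀ k, IsBesselSeq 𝕜 (f k)) : IsBesselSeq 𝕜 (fun n => ∑ k, f k n) := by
  simp only [isBesselSeq_iff] at h ⊢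
  choose C hC using h
  refine ⟨Fintype.card κ * ∑ k, C k, fun x => (besselSum_sum_le 𝕜 f x).trans ?_⟩
  push_cast
  rw [mul_assoc, Finset.sum_mul]
  gcongr with k
  exact hC k x

end FrameBounds

/-! ### Separating linearly independent sequences -/

section Separation

/-- Linearly independent functions are separated by finite combinations of point evaluations. -/
theorem LinearIndependent.exists_dual_combination {K κ X : Type*} [Field K] [Fintype κ]
    [DecidableEq κ] {φ : κ → X → K} (h : LinearIndependent K φ) (k₀ : κ) :
    ∃ c : X →₀ K, ∀ k, ∑ x ∈ c.support, c x * φ k x = if k = k₀ then 1 else 0 := by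
  -- A nonzero functional vanishing on all vectors `(φ k x)ₖ` would be a linear relation among the
  -- `φ k`.
  have htop : Submodule.span K (Set.range fun x k => φ k x) = ⊤ := by
    by_contra hne
    obtain ⟨F, hF, hle⟩ := Submodule.exists_le_ker_of_lt_top _ (lt_top_iff_ne_top.mpr hne)
    refine hF ?_
    have hzero : ∑ k, F (Pi.single k 1) • φ k = 0 := by
      ext x
      have hx : F (fun k => φ k x) = 0 := hle (Submodule.subset_span ⟨x, rfl⟩)
      rw [LinearMap.pi_apply_eq_sum_univ] at hx
      rw [Finset.sum_apply, Pi.zero_apply, ← hx]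
      simp only [Pi.smul_apply, smul_eq_mul]
      refine Finset.sum_congr rfl fun k _ => ?_
      rw [mul_comm]
      congr 2
      ext l
      simp [Pi.single_apply, eq_comm]
    have hk := Fintype.linearIndependent_iff.mp h _ hzero
    refine LinearMap.pi_ext' fun k => LinearMap.ext_ring ?_
    simpa using hk k
  obtain ⟨c, hc⟩ := Finsupp.mem_span_range_iff_exists_finsupp.mp
    (htop ▸ Submodule.mem_top : (Pi.single k₀ 1 : κ → K) ∈ _)
  refine ⟨c, fun k => ?_⟩
  have := congrFun hc k
  simpa [Finsupp.sum, Pi.single_apply] using this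

/-- A vector is determined by its inner products, so passing to scalar functions on `N × E` loses no
independence. -/
theorem LinearIndependent.inner_apply {𝕜 : Type*} [RCLike 𝕜] {κ N E : Type*}
    [NormedAddCommGroup E] [InnerProductSpace 𝕜 E] [Fintype κ] {f : κ → N → E}
    (h : LinearIndependent 𝕜 f) :
    LinearIndependent 𝕜 fun k (p : N × E) => (inner 𝕜 p.2 (f k p.1) : 𝕜) := by
  rw [Fintype.linearIndependent_iff] at h ⊢
  intro g hg
  refine h g (funext fun n => ext_inner_left 𝕜 fun v => ?_)
  have := congrFun hg (n, v)
  simpa [inner_sum, inner_smul_right] using this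

end Separation

/-! ### The two implications for sums of tensor families -/

section TensorSums

variable {ι : Type*} [Fintype ι] [DecidableEq ι] {𝕜 : Type*} [RCLike 𝕜]
  {H : ι → Type*} [∀ j, NormedAddCommGroup (H j)] [∀ j, InnerProductSpace 𝕜 (H j)]

theorem HilbertTensor.inner_pure_eq_mul (v w : ∀ j, H j) (i : ι) :
    inner 𝕜 (HilbertTensor.pure 𝕜 v) (HilbertTensor.pure 𝕜 w) =
      inner 𝕜 (v i) (w i) * ∏ j : { j // j ≠ i }, inner 𝕜 (v j) (w j) := by
  rw [HilbertTensor.inner_pure, Fintype.prod_eq_mul_prod_subtype_ne _ i]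

theorem besselSum_pure_pure {L : ι → Type*} (g : ∀ j, L j → H j) (w : ∀ j, H j) (i : ι) :
    besselSum 𝕜 (fun n : ∀ j, L j => HilbertTensor.pure 𝕜 fun j => g j (n j))
        (HilbertTensor.pure 𝕜 w) =
      besselSum 𝕜 (g i) (w i) *
        ∑' m : ∀ j : { j // j ≠ i }, L j, ∏ j : { j // j ≠ i }, ‖inner 𝕜 (w j) (g j (m j))‖ₑ ^ 2 := by
  simp only [besselSum]
  rw [← (Equiv.piSplitAt i L).symm.tsum_eq, ENNReal.tsum_prod', ← ENNReal.tsum_mul_right]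
  refine tsum_congr fun a => ?_
  rw [← ENNReal.tsum_mul_left]
  refine tsum_congr fun m => ?_
  have hm : ∀ j : { j // j ≠ i }, (Equiv.piSplitAt i L).symm (a, m) j = m j := fun j => by
    simp [Equiv.piSplitAt, j.2]
  have ha : (Equiv.piSplitAt i L).symm (a, m) i = a := by simp [Equiv.piSplitAt]
  rw [HilbertTensor.inner_pure_eq_mul _ _ i, enorm_mul, mul_pow, ha]
  simp only [hm, enorm_eq_nnnorm, nnnorm_prod]
  push_cast
  rw [Finset.prod_pow]

variable {κ N : Type*} [Fintype κ]

theorem isBesselSeq_tensorSumSeq [∀ j, CompleteSpace (H j)] {f : ∀ j, κ → N → H j}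
    (h : ∀ j k, IsBesselSeq 𝕜 (f j k)) : IsBesselSeq 𝕜 (tensorSumSeq 𝕜 f) := by
  refine IsBesselSeq.sum 𝕜 (f := fun k (n : ι → N) => HilbertTensor.pure 𝕜 fun j => f j k (n j))
    fun k => ?_
  simp only [isBesselSeq_iff] at h ⊢
  choose C hC using fun j => h j k
  refine ⟨∏ j, C j, fun x => ?_⟩
  rw [ENNReal.ofNNReal_finsetProd]
  exact besselSum_pure_le hC x

theorem IsBesselSeq.of_tensorSumSeq [Nontrivial ι] {f : ∀ j, κ → N → H j}
    (hf : ∀ j, LinearIndependent 𝕜 (f j)) (h : IsBesselSeq 𝕜 (tensorSumSeq 𝕜 f)) (i : ι)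
    (k₀ : κ) : IsBesselSeq 𝕜 (f i k₀) := by
  classical
  obtain ⟨C, hC⟩ := (isBesselSeq_iff 𝕜).mp h
  choose c hc using fun j => (hf j).inner_apply.exists_dual_combination k₀
  let s : Finset (∀ j : { j // j ≠ i }, N × H j) := Fintype.piFinset fun j => (c j).support
  let v : H i → (∀ j : { j // j ≠ i }, N × H j) → ∀ j, H j := fun x p =>
    (Equiv.piSplitAt i H).symm (x, fun j => (p j).2)
  let ν : N → (∀ j : { j // j ≠ i }, N × H j) → ι → N := fun n p =>
    (Equiv.piSplitAt i fun _ => N).symm (n, fun j => (p j).1)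
  have hvi : ∀ x p, v x p i = x := fun x p => by simp [v, Equiv.piSplitAt]
  have hv : ∀ x p (j : { j // j ≠ i }), v x p j = (p j).2 := fun x p j => by
    simp [v, Equiv.piSplitAt, j.2]
  have hνi : ∀ n p, ν n p i = n := fun n p => by simp [ν, Equiv.piSplitAt]
  have hν : ∀ n p (j : { j // j ≠ i }), ν n p j = (p j).1 := fun n p j => by
    simp [ν, Equiv.piSplitAt, j.2]
  -- A second slot is essential: over an empty set of slots the product in `hsep` is 1 for every
  -- `k`.
  obtain ⟨j₀, hj₀⟩ := exists_ne i
  have hsep : ∀ k, ∑ p ∈ s, ∏ j : { j // j ≠ i }, c j (p j) * inner 𝕜 (p j).2 (f j k (p j).1) =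
      if k = k₀ then 1 else 0 := fun k => by
    have h1 := Finset.prod_univ_sum (fun j : { j // j ≠ i } => (c j).support)
      fun j p => c j p * inner 𝕜 p.2 (f j k p.1)
    refine h1.symm.trans ?_
    simp only [hc]
    split_ifs
    · simp
    · exact Finset.prod_eq_zero (Finset.mem_univ ⟨j₀, hj₀⟩) rfl
  have hrep : ∀ x n, inner 𝕜 x (f i k₀ n) = ∑ p ∈ s, (∏ j : { j // j ≠ i }, c j (p j)) *
      inner 𝕜 (HilbertTensor.pure 𝕜 (v x p)) (tensorSumSeq 𝕜 f (ν n p)) := fun x n => by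
    simp only [tensorSumSeq, inner_sum, HilbertTensor.inner_pure_eq_mul _ _ i, hvi, hv, hνi, hν,
      Finset.mul_sum]
    rw [Finset.sum_comm]
    have : ∀ k, ∑ p ∈ s, (∏ j : { j // j ≠ i }, c j (p j)) * (inner 𝕜 x (f i k n) *
        ∏ j : { j // j ≠ i }, inner 𝕜 (p j).2 (f j k (p j).1)) =
        inner 𝕜 x (f i k n) * if k = k₀ then 1 else 0 := fun k => by
      rw [← hsep, Finset.mul_sum]
      refine Finset.sum_congr rfl fun p _ => ?_
      rw [Finset.prod_mul_distrib]
      ring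
    simp [this]
  -- Squared coefficient, times the bound of the tensor family, times the squared norms of the test
  -- vectors outside slot `i`.
  let M : (∀ j : { j // j ≠ i }, N × H j) → ℝ≥0 := fun p =>
    (∏ j : { j // j ≠ i }, ‖c j (p j)‖₊) ^ 2 * (C * ∏ j : { j // j ≠ i }, ‖(p j).2‖₊ ^ 2)
  refine (isBesselSeq_iff 𝕜).mpr ⟨s.card * ∑ p ∈ s, M p, fun x => ?_⟩
  have hbound : ∀ p, ∑' n, ‖(∏ j : { j // j ≠ i }, c j (p j)) *
      inner 𝕜 (HilbertTensor.pure 𝕜 (v x p)) (tensorSumSeq 𝕜 f (ν n p))‖ₑ ^ 2 ≤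
        M p * ‖x‖ₑ ^ 2 := fun p => by
    have hinj : Function.Injective fun n => ν n p := fun n n' hn => by
      simpa only [hνi] using congrFun hn i
    have h1 := (ENNReal.tsum_comp_le_tsum_of_injective hinj _).trans
      (hC (HilbertTensor.pure 𝕜 (v x p)))
    rw [HilbertTensor.enorm_pure, Fintype.prod_eq_mul_prod_subtype_ne _ i, hvi] at h1
    simp only [hv] at h1
    simp only [enorm_mul, mul_pow]
    rw [ENNReal.tsum_mul_left]
    refine (mul_le_mul_right h1 _).trans (le_of_eq ?_)
    simp only [M, nnnorm_prod, Finset.prod_pow, enorm_eq_nnnorm]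
    push_cast
    ring
  calc besselSum 𝕜 (f i k₀) x
      ≤ ∑' n, s.card * ∑ p ∈ s, ‖(∏ j : { j // j ≠ i }, c j (p j)) *
          inner 𝕜 (HilbertTensor.pure 𝕜 (v x p)) (tensorSumSeq 𝕜 f (ν n p))‖ₑ ^ 2 := by
        refine ENNReal.tsum_le_tsum fun n => ?_
        rw [hrep]
        exact enorm_sum_sq_le _ _
    _ ≤ s.card * ∑ p ∈ s, M p * ‖x‖ₑ ^ 2 := by
        rw [ENNReal.tsum_mul_left, Summable.tsum_finsetSum fun _ _ => ENNReal.summable]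
        gcongr with p
        exact hbound p
    _ = _ := by
        push_cast
        rw [mul_assoc, Finset.sum_mul]

theorem IsFrameSeq.of_tensorSumSeq [∀ j, CompleteSpace (H j)] [Nontrivial ι] [Nonempty κ]
    {f : ∀ j, κ → N → H j} (hf : ∀ j, LinearIndependent 𝕜 (f j))
    (h : IsFrameSeq 𝕜 (tensorSumSeq 𝕜 f)) (i : ι) :
    IsFrameSeq 𝕜 (fun p : κ × N => f i p.1 p.2) := by
  obtain ⟨hB, A, hA, hlow⟩ := (isFrameSeq_iff 𝕜).mp h
  have hbes := IsBesselSeq.of_tensorSumSeq hf hB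
  refine (isFrameSeq_iff 𝕜).mpr ⟨IsBesselSeq.prod 𝕜 (hbes i), ?_⟩
  have hne : ∀ j k, ∃ n, f j k n ≠ 0 := fun j k => Function.ne_iff.mp ((hf j).ne_zero k)
  choose n hn using hne
  let k₁ : κ := Classical.arbitrary κ
  -- Any nonzero vectors would do; independence guarantees a nonzero entry in each sequence.
  let e : ∀ j, H j := fun j => f j k₁ (n j k₁)
  let D : κ → ℝ≥0∞ := fun k =>
    ∑' m : { j // j ≠ i } → N, ∏ j : { j // j ≠ i }, ‖inner 𝕜 (e j) (f j k (m j))‖ₑ ^ 2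
  have hpure : ∀ k x, besselSum 𝕜
      (fun m : ι → N => HilbertTensor.pure 𝕜 fun j => f j k (m j))
        (HilbertTensor.pure 𝕜 (Function.update e i x)) = besselSum 𝕜 (f i k) x * D k := by
    intro k x
    rw [besselSum_pure_pure _ _ i, Function.update_self]
    congr! 6 with m j
    simp [j.2]
  have hD : ∀ k, D k ≠ ∞ := by
    intro k hk
    choose C hC using fun j => (isBesselSeq_iff 𝕜).mp (hbes j k)
    -- Testing with a nonzero entry of `f i k` makes the first factor nonzero, so `D k = ∞` would
    -- violate the finite product bound.
    have h1 := besselSum_pure_le hC (HilbertTensor.pure 𝕜 (Function.update e i (f i k (n i k))))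
    have h2 : besselSum 𝕜 (f i k) (f i k (n i k)) ≠ 0 := by
      intro h0
      have := ENNReal.tsum_eq_zero.mp h0 (n i k)
      simp [hn i k] at this
    rw [hpure, hk, ENNReal.mul_top h2, ← ENNReal.ofNNReal_finsetProd] at h1
    exact absurd h1 (not_le.mpr (by finiteness))
  let P : ℝ≥0∞ := ∏ j : { j // j ≠ i }, ‖e j‖ₑ ^ 2
  have hP : P ≠ 0 := Finset.prod_ne_zero_iff.mpr fun j _ => by simp [e, hn]
  have hP' : P ≠ ∞ := ENNReal.prod_ne_top fun j _ => by finiteness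
  -- The summand 1 keeps `R` nonzero, so that `A * P / R` is finite.
  let R : ℝ≥0∞ := Fintype.card κ * ∑ k, D k + 1
  have hR : R ≠ ∞ := by
    have : ∑ k, D k ≠ ∞ := ENNReal.sum_ne_top.mpr fun k _ => hD k
    finiteness
  have hR0 : R ≠ 0 := by simp [R]
  have hmain : ∀ x, A * P * ‖x‖ₑ ^ 2 ≤ R * ∑ k, besselSum 𝕜 (f i k) x := by
    intro x
    have h1 := hlow (HilbertTensor.pure 𝕜 (Function.update e i x))
    have h2 : ‖(HilbertTensor.pure 𝕜 (Function.update e i x) : HilbertTensor 𝕜 H)‖ₑ ^ 2 =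
        P * ‖x‖ₑ ^ 2 := by
      rw [HilbertTensor.enorm_pure, Fintype.prod_eq_mul_prod_subtype_ne _ i, Function.update_self,
        mul_pow, ← Finset.prod_pow, mul_comm]
      congr! 4 with j
      simp [j.2]
    rw [h2, ← mul_assoc] at h1
    refine h1.trans ((besselSum_sum_le 𝕜 _ _).trans ?_)
    simp only [hpure]
    calc (Fintype.card κ : ℝ≥0∞) * ∑ k, besselSum 𝕜 (f i k) x * D k
        ≤ Fintype.card κ * ∑ k, besselSum 𝕜 (f i k) x * ∑ l, D l := by
          gcongr with k
          exact Finset.single_le_sum (fun _ _ => zero_le) (Finset.mem_univ k)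
      _ = (Fintype.card κ * ∑ k, D k) * ∑ k, besselSum 𝕜 (f i k) x := by
          rw [← Finset.sum_mul]; ring
      _ ≤ R * ∑ k, besselSum 𝕜 (f i k) x := by
          gcongr
          exact le_self_add
  have hfin : A * P / R ≠ ∞ := ENNReal.div_ne_top (by finiteness) hR0
  refine ⟨(A * P / R).toNNReal, ENNReal.toNNReal_pos ?_ hfin, fun x => ?_⟩
  · exact (ENNReal.div_pos (mul_ne_zero (by simpa using hA.ne') hP) hR).ne'
  · rw [ENNReal.coe_toNNReal hfin, besselSum_prod, div_eq_mul_inv, mul_right_comm,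
      ← div_eq_mul_inv]
    exact ENNReal.div_le_of_le_mul' (hmain x)

end TensorSums

theorem theorem1p3 {𝕜 : Type*} [RCLike 𝕜] (d r : ℕ) (hd : 1 < d) (hr : 1 ≤ r)
    (H : Fin d → Type*) [∀ j, NormedAddCommGroup (H j)] [∀ j, InnerProductSpace 𝕜 (H j)]
    [∀ j, CompleteSpace (H j)] [∀ j, TopologicalSpace.SeparableSpace (H j)]
    (f : ∀ j, Fin r → ℕ+ → H j) (hf : ∀ j, LinearIndependent 𝕜 (f j)) :
    (IsBesselSeq 𝕜 (tensorSumSeq 𝕜 f) ↔ ∀ j k, IsBesselSeq 𝕜 (f j k)) ∧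
    (IsFrameSeq 𝕜 (tensorSumSeq 𝕜 f) →
      ∀ j, IsFrameSeq 𝕜 (fun p : Fin r × ℕ+ => f j p.1 p.2)) := by
  have : Nontrivial (Fin d) := Fin.nontrivial_iff_two_le.mpr hd
  have : Nonempty (Fin r) := ⟨⟨0, hr⟩⟩
  exact ⟨⟨IsBesselSeq.of_tensorSumSeq hf, isBesselSeq_tensorSumSeq⟩, IsFrameSeq.of_tensorSumSeq hf⟩
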